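/- We have \[ \sum_{\substack{k,m,n\ge 1\\ k\text{ odd}}} \frac{1}{3^n}\,\frac{1}{k(k+m)(k+m+n)} = \frac{13}{48}\,\zeta(3), \] where the sum is over all triples $(k,m,n)$ of positive integers with $k$ odd, the (positive-term) series converges, and $\zeta$ denotes the Riemann zeta function. -/

import Mathlib

open Filter Topology Set MeasureTheory

/-! Since `1/(k+m) - 1/(k+m+n) = n/((k+m)(k+m+n))`, each summand is the integral over `(0,1)` of
`(t^k/k) * t^(m-1) * ((1/3)^n - (t/3)^n)/n`. Summing the three factors separately gives the closed
form `artanh t * (1-t)⁻¹ * log((3-t)/2)`, which is `sumKernel`; all terms are nonnegative, so sum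
and integral may be exchanged once this kernel is integrable.

With `u = (1-t)/2` the integral becomes `1/2 * ∫_0^(1/2) (log(1-u) - log u) * log(1+u) / u du`.
Polarization turns the product `log(1-u) * log(1+u)` into squares of logarithms, each divided by `u`
having an antiderivative in `Li₂` and `Li₃`; `primMain` collects these.

At `u = 0` only `Li₃(±1)` survive. At `u = 1/2` the arguments `1/4, 3/4, 1/3, 2/3, ±1/2, -1/3`
occur, and duplication, Euler reflection and Landen's identities for `Li₂` and `Li₃` remove
everything but `ζ(3)`. The answer is `1/2 * (35/24 - 11/12) = 13/48`. -/

/-! ### Polylogarithms: convergence, derivatives, special values. -/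

/-- The real polylogarithm `∑ xⁿ / nˢ`, as a power series. -/
noncomputable def polylog (s : ℕ) (x : ℝ) : ℝ := ∑' n : ℕ, x ^ (n + 1) / ((n : ℝ) + 1) ^ s

lemma polylog_zero_right (s : ℕ) : polylog s 0 = 0 := by
  simp [polylog]

lemma summable_inv_succ_pow {s : ℕ} (hs : 2 ≤ s) : Summable fun n : ℕ => 1 / ((n : ℝ) + 1) ^ s := by
  have h := (summable_nat_add_iff 1).2 (Real.summable_one_div_nat_pow.2 (by omega : 1 < s))
  simpa using h

lemma norm_polylog_term_le {s : ℕ} {x : ℝ} (hx : x ∈ Icc (-1 : ℝ) 1) (n : ℕ) :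
    ‖x ^ (n + 1) / ((n : ℝ) + 1) ^ s‖ ≤ 1 / ((n : ℝ) + 1) ^ s := by
  have h0 : (0 : ℝ) < ((n : ℝ) + 1) ^ s := by positivity
  rw [norm_div, norm_pow, Real.norm_eq_abs, Real.norm_eq_abs, abs_of_pos h0]
  gcongr
  exact pow_le_one₀ (abs_nonneg x) (abs_le.2 hx)

lemma summable_polylog {s : ℕ} (hs : 2 ≤ s) {x : ℝ} (hx : x ∈ Icc (-1 : ℝ) 1) :
    Summable fun n : ℕ => x ^ (n + 1) / ((n : ℝ) + 1) ^ s :=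
  Summable.of_norm_bounded (summable_inv_succ_pow hs) (norm_polylog_term_le hx)

lemma continuousOn_polylog {s : ℕ} (hs : 2 ≤ s) : ContinuousOn (polylog s) (Icc (-1) 1) :=
  continuousOn_tsum (fun n => by fun_prop) (summable_inv_succ_pow hs)
    (fun n _ hx => norm_polylog_term_le hx n)

/-- The derivative is kept as a series so that `x = 0` is included; this is needed for the limits at
`0`. -/
lemma hasDerivAt_polylog_series (s : ℕ) {x : ℝ} (hx : x ∈ Ioo (-1 : ℝ) 1) :
    HasDerivAt (polylog (s + 1)) (∑' n : ℕ, x ^ n / ((n : ℝ) + 1) ^ s) x := by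
  obtain ⟨r, hxr, hr⟩ := exists_between (abs_lt.2 hx)
  have hr0 : 0 ≤ r := (abs_nonneg x).trans hxr.le
  refine hasDerivAt_tsum_of_isPreconnected (u := fun n => r ^ n) (t := Ioo (-r) r) (y₀ := 0)
    (g := fun (n : ℕ) (x : ℝ) => x ^ (n + 1) / ((n : ℝ) + 1) ^ (s + 1))
    (g' := fun (n : ℕ) (x : ℝ) => x ^ n / ((n : ℝ) + 1) ^ s)
    (summable_geometric_of_lt_one hr0 hr) isOpen_Ioo isPreconnected_Ioo ?_ ?_ ?_ ?_ ?_
  · intro n y _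
    have h := (hasDerivAt_pow (n + 1) y).div_const (((n : ℝ) + 1) ^ (s + 1))
    have hn : (n : ℝ) + 1 ≠ 0 := by positivity
    refine h.congr_deriv ?_
    rw [Nat.add_sub_cancel]
    push_cast
    field_simp
    ring
  · intro n y hy
    have h1 : (1 : ℝ) ≤ ((n : ℝ) + 1) ^ s := one_le_pow₀ (by linarith [n.cast_nonneg (α := ℝ)])
    rw [norm_div, norm_pow, Real.norm_eq_abs, Real.norm_eq_abs,
      abs_of_pos (zero_lt_one.trans_le h1)]
    refine (div_le_self (by positivity) h1).trans ?_
    gcongr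
    exact (abs_lt.2 hy).le
  · have := (abs_nonneg x).trans_lt hxr
    exact ⟨by linarith, this⟩
  · simp [summable_zero]
  · exact abs_lt.1 hxr

lemma hasDerivAt_polylog (s : ℕ) {x : ℝ} (hx : x ∈ Ioo (-1 : ℝ) 1) (h0 : x ≠ 0) :
    HasDerivAt (polylog (s + 1)) (polylog s x / x) x := by
  have h := hasDerivAt_polylog_series s hx
  have e : polylog s x / x = ∑' n : ℕ, x ^ n / ((n : ℝ) + 1) ^ s := by
    rw [polylog, ← tsum_div_const]
    refine tsum_congr fun n => ?_
    have hn : (n : ℝ) + 1 ≠ 0 := by positivity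
    field_simp
    ring
  rwa [e]

lemma polylog_one {x : ℝ} (hx : x ∈ Ioo (-1 : ℝ) 1) : polylog 1 x = -Real.log (1 - x) := by
  have h := Real.hasSum_pow_div_log_of_abs_lt_one (abs_lt.2 hx)
  simpa [polylog] using h.tsum_eq

lemma hasDerivAt_dilog {x : ℝ} (hx : x ∈ Ioo (-1 : ℝ) 1) (h0 : x ≠ 0) :
    HasDerivAt (polylog 2) (-Real.log (1 - x) / x) x := by
  simpa [polylog_one hx] using hasDerivAt_polylog 1 hx h0

lemma hasDerivAt_trilog {x : ℝ} (hx : x ∈ Ioo (-1 : ℝ) 1) (h0 : x ≠ 0) :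
    HasDerivAt (polylog 3) (polylog 2 x / x) x :=
  hasDerivAt_polylog 2 hx h0

lemma polylog_two_one : polylog 2 1 = Real.pi ^ 2 / 6 := by
  have h := (hasSum_nat_add_iff' 1).2 hasSum_zeta_two
  simpa [polylog] using h.tsum_eq

lemma ofReal_polylog_three_one : ((polylog 3 1 : ℝ) : ℂ) = riemannZeta 3 := by
  have h := zeta_nat_eq_tsum_of_gt_one (k := 3) (by norm_num)
  have hs : Summable fun n : ℕ => 1 / (n : ℂ) ^ 3 := by
    simpa using Complex.ofRealCLM.summable
      (Real.summable_one_div_nat_pow.2 (by norm_num : 1 < 3))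
  rw [hs.tsum_eq_zero_add] at h
  push_cast at h
  rw [h, polylog, Complex.ofReal_tsum]
  simp

/-- The duplication formula. -/
lemma polylog_sq {s : ℕ} (hs : 1 ≤ s) {x : ℝ} (hx : x ∈ Icc (-1 : ℝ) 1) :
    polylog (s + 1) (x ^ 2) = 2 ^ s * (polylog (s + 1) x + polylog (s + 1) (-x)) := by
  have hx' : -x ∈ Icc (-1 : ℝ) 1 := ⟨by linarith [hx.2], by linarith [hx.1]⟩
  have h1 := summable_polylog (by omega : 2 ≤ s + 1) hx
  have h2 := summable_polylog (by omega : 2 ≤ s + 1) hx'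
  set f : ℕ → ℝ := fun n =>
    x ^ (n + 1) / ((n : ℝ) + 1) ^ (s + 1) + (-x) ^ (n + 1) / ((n : ℝ) + 1) ^ (s + 1) with hf
  have hsum : Summable f := h1.add h2
  have hadd : polylog (s + 1) x + polylog (s + 1) (-x) = ∑' n : ℕ, f n :=
    (h1.tsum_add h2).symm
  have he := tsum_even_add_odd (f := f)
    (hsum.comp_injective (i := fun k => 2 * k) fun a b h => by simpa using h)
    (hsum.comp_injective (i := fun k => 2 * k + 1) fun a b h => by simpa using h)
  -- Index `n` carries the power `n + 1`, so even indices are the odd powers, which cancel.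
  have hz : ∀ k : ℕ, f (2 * k) = 0 := by
    intro k
    simp only [hf]
    rw [Odd.neg_pow ⟨k, rfl⟩]
    ring
  have ho : ∀ k : ℕ, (x ^ 2) ^ (k + 1) / ((k : ℝ) + 1) ^ (s + 1) = 2 ^ s * f (2 * k + 1) := by
    intro k
    simp only [hf]
    rw [Even.neg_pow ⟨k + 1, by ring⟩]
    push_cast
    have e : (2 * (k : ℝ) + 1 + 1) = 2 * (k + 1) := by ring
    have hk : (k : ℝ) + 1 ≠ 0 := by positivity
    rw [e, mul_pow, ← pow_mul]
    field_simp
    ring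
  simp only [hz, tsum_zero, zero_add] at he
  rw [hadd, ← he, polylog, ← tsum_mul_left]
  exact tsum_congr ho

lemma trilog_neg_one : polylog 3 (-1) = -(3 / 4) * polylog 3 1 := by
  have h := polylog_sq (s := 2) (by norm_num) (x := 1) (by norm_num)
  norm_num at h
  linarith

/-! ### Limits at endpoints. -/

/-- Here `f u = O(u)` and `u log u → 0`. The two-sided neighbourhood is harmless because `Real.log
u` is `log |u|`, with value `0` at `0`. -/
lemma tendsto_log_mul_zero {f : ℝ → ℝ} {f' : ℝ} (hf : HasDerivAt f f' 0) (h0 : f 0 = 0) :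
    Tendsto (fun u => Real.log u * f u) (𝓝 0) (𝓝 0) := by
  have h1 : (fun u => f u) =O[𝓝 0] fun u : ℝ => u := by
    simpa [h0] using hf.isBigO_sub
  have h2 : Tendsto (fun u : ℝ => Real.log u * u) (𝓝 0) (𝓝 0) := by
    have := Real.continuous_mul_log.tendsto 0
    simpa [mul_comm] using this
  exact ((Asymptotics.isBigO_refl (fun u : ℝ => Real.log u) (𝓝 0)).mul h1).trans_tendsto h2

lemma tendsto_polylog {s : ℕ} (hs : 2 ≤ s) {l : Filter ℝ} {g : ℝ → ℝ} {y : ℝ}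
    (hg : Tendsto g l (𝓝 y)) (hy : y ∈ Icc (-1 : ℝ) 1) (h : ∀ᶠ x in l, g x ∈ Icc (-1 : ℝ) 1) :
    Tendsto (fun x => polylog s (g x)) l (𝓝 (polylog s y)) :=
  (continuousOn_polylog hs y hy).tendsto.comp (tendsto_nhdsWithin_iff.2 ⟨hg, h⟩)

/-- Used for the functional equations below: differentiate, then read off the constant as a limit at
`0`. -/
lemma eq_of_hasDerivAt_zero_of_tendsto {f : ℝ → ℝ} {a b c : ℝ}
    (hf : ∀ x ∈ Ioo a b, HasDerivAt f 0 x) (hlim : Tendsto f (𝓝[Ioo a b] a) (𝓝 c)) {x : ℝ}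
    (hx : x ∈ Ioo a b) : f x = c := by
  have : (𝓝[Ioo a b] a).NeBot := left_nhdsWithin_Ioo_neBot (hx.1.trans hx.2)
  have hconst : ∀ y ∈ Ioo a b, f y = f x := fun y hy =>
    isOpen_Ioo.is_const_of_deriv_eq_zero isPreconnected_Ioo
      (fun z hz => (hf z hz).differentiableAt.differentiableWithinAt)
      (fun z hz => (hf z hz).deriv) hy hx
  refine tendsto_nhds_unique (tendsto_const_nhds.congr' ?_) hlim
  filter_upwards [self_mem_nhdsWithin] with y hy using (hconst y hy).symm

/-! ### Functional equations of the dilogarithm and trilogarithm. -/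

lemma hasDerivAt_log_one_sub {x : ℝ} (hx : x < 1) :
    HasDerivAt (fun u : ℝ => Real.log (1 - u)) (-1 / (1 - x)) x :=
  ((hasDerivAt_id x).const_sub 1).log (by simp; linarith)

lemma hasDerivAt_log_one_sub_sq_zero :
    HasDerivAt (fun u : ℝ => Real.log (1 - u) ^ 2) 0 0 :=
  ((hasDerivAt_log_one_sub one_pos).pow 2).congr_deriv (by simp)

/-- Euler's reflection formula for the dilogarithm. -/
lemma dilog_add_dilog_one_sub {x : ℝ} (hx : x ∈ Ioo (0 : ℝ) 1) :
    polylog 2 x + polylog 2 (1 - x) = Real.pi ^ 2 / 6 - Real.log x * Real.log (1 - x) := by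
  suffices h : polylog 2 x + polylog 2 (1 - x) + Real.log x * Real.log (1 - x)
      = Real.pi ^ 2 / 6 by linarith
  refine eq_of_hasDerivAt_zero_of_tendsto (a := 0) (b := 1)
    (f := fun x => polylog 2 x + polylog 2 (1 - x) + Real.log x * Real.log (1 - x)) ?_ ?_ hx
  · rintro x ⟨h0, h1⟩
    have h0' : x ≠ 0 := h0.ne'
    have h1' : 1 - x ≠ 0 := by linarith
    have d1 := hasDerivAt_dilog (x := x) ⟨by linarith, h1⟩ h0'
    have d2 := (hasDerivAt_dilog (x := 1 - x) ⟨by linarith, by linarith⟩ h1').comp x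
      ((hasDerivAt_id x).const_sub 1)
    have d3 := (Real.hasDerivAt_log h0').mul (hasDerivAt_log_one_sub h1)
    refine ((d1.add d2).add d3).congr_deriv ?_
    rw [sub_sub_cancel]
    field_simp
    ring
  · have hw : 𝓝[Ioo (0 : ℝ) 1] 0 ≤ 𝓝 0 := nhdsWithin_le_nhds
    have hm : ∀ᶠ x in 𝓝[Ioo (0 : ℝ) 1] 0, x ∈ Ioo (0 : ℝ) 1 := self_mem_nhdsWithin
    have t1 := tendsto_polylog (s := 2) le_rfl (g := fun x => x) (y := 0) (tendsto_id.mono_left hw) (by norm_num)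
      (hm.mono fun x h => ⟨by linarith [h.1], h.2.le⟩)
    have t2 := tendsto_polylog (s := 2) le_rfl (l := 𝓝[Ioo (0 : ℝ) 1] 0) (g := fun x => 1 - x)
      (y := 1) (by
        have : Tendsto (fun x : ℝ => 1 - x) (𝓝 0) (𝓝 (1 - 0)) := by
          exact (continuous_const.sub continuous_id).tendsto 0
        simpa using this.mono_left hw) (by norm_num)
      (hm.mono fun x h => ⟨by linarith [h.2], by linarith [h.1]⟩)
    have t3 := (tendsto_log_mul_zero (hasDerivAt_log_one_sub (x := 0) one_pos)
      (by simp)).mono_left hw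
    simpa [polylog_zero_right, polylog_two_one] using (t1.add t2).add t3

lemma landen_arg_mem {x : ℝ} (hx : x ∈ Ioo (0 : ℝ) (1 / 2)) : x / (x - 1) ∈ Ioo (-1 : ℝ) 0 := by
  have h : x - 1 < 0 := by linarith [hx.2]
  exact ⟨by rw [lt_div_iff_of_neg h]; linarith [hx.2], div_neg_of_pos_of_neg hx.1 h⟩

lemma hasDerivAt_landen_arg {x : ℝ} (hx : x < 1) :
    HasDerivAt (fun x : ℝ => x / (x - 1)) (-1 / (x - 1) ^ 2) x := by
  have h : x - 1 ≠ 0 := by linarith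
  exact ((hasDerivAt_id x).div ((hasDerivAt_id x).sub_const 1) h).congr_deriv (by simp)

lemma one_sub_landen_arg {x : ℝ} (hx : x < 1) : 1 - x / (x - 1) = (1 - x)⁻¹ := by
  have h : x - 1 ≠ 0 := by linarith
  have h' : 1 - x ≠ 0 := by linarith
  field_simp
  ring

lemma tendsto_landen_arg : Tendsto (fun x : ℝ => x / (x - 1)) (𝓝 0) (𝓝 0) := by
  simpa using (hasDerivAt_landen_arg one_pos).continuousAt.tendsto

/-- Landen's identity for the dilogarithm. -/
lemma dilog_landen {x : ℝ} (hx : x ∈ Ioo (0 : ℝ) (1 / 2)) :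
    polylog 2 x + polylog 2 (x / (x - 1)) = -(1 / 2) * Real.log (1 - x) ^ 2 := by
  suffices h : polylog 2 x + polylog 2 (x / (x - 1)) + (1 / 2) * Real.log (1 - x) ^ 2 = 0 by
    linarith
  refine eq_of_hasDerivAt_zero_of_tendsto (a := 0) (b := 1 / 2)
    (f := fun x => polylog 2 x + polylog 2 (x / (x - 1)) + (1 / 2) * Real.log (1 - x) ^ 2) ?_ ?_ hx
  · intro x hx
    have hx1 : x < 1 := by linarith [hx.2]
    have h0' : x ≠ 0 := hx.1.ne'
    have h1' : 1 - x ≠ 0 := by linarith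
    have h1'' : x - 1 ≠ 0 := by linarith
    have hm := landen_arg_mem hx
    have d1 := hasDerivAt_dilog (x := x) ⟨by linarith [hx.1], hx1⟩ h0'
    have d2 := (hasDerivAt_dilog ⟨hm.1, by linarith [hm.2]⟩ hm.2.ne).comp x
      (hasDerivAt_landen_arg hx1)
    have d3 := ((hasDerivAt_log_one_sub hx1).pow 2).const_mul (1 / 2 : ℝ)
    refine ((d1.add d2).add d3).congr_deriv ?_
    rw [one_sub_landen_arg hx1, Real.log_inv]
    have e : x - 1 = -(1 - x) := by ring
    rw [e]
    field_simp
    push_cast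
    ring
  · have hw : 𝓝[Ioo (0 : ℝ) (1 / 2)] 0 ≤ 𝓝 0 := nhdsWithin_le_nhds
    have hm : ∀ᶠ x in 𝓝[Ioo (0 : ℝ) (1 / 2)] 0, x ∈ Ioo (0 : ℝ) (1 / 2) := self_mem_nhdsWithin
    have t1 := tendsto_polylog (s := 2) le_rfl (g := fun x => x) (y := 0) (tendsto_id.mono_left hw) (by norm_num)
      (hm.mono fun x h => ⟨by linarith [h.1], by linarith [h.2]⟩)
    have t2 := tendsto_polylog (s := 2) le_rfl (tendsto_landen_arg.mono_left hw) (by norm_num)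
      (hm.mono fun x h => ⟨(landen_arg_mem h).1.le, by linarith [(landen_arg_mem h).2]⟩)
    have t3 := (hasDerivAt_log_one_sub_sq_zero.continuousAt.tendsto.mono_left hw).const_mul
      (1 / 2 : ℝ)
    simpa [polylog_zero_right] using (t1.add t2).add t3

/-- Landen's identity for the trilogarithm. -/
lemma trilog_landen {x : ℝ} (hx : x ∈ Ioo (0 : ℝ) (1 / 2)) :
    polylog 3 (1 - x) + polylog 3 x + polylog 3 (x / (x - 1)) - (1 / 6) * Real.log (1 - x) ^ 3
      - Real.pi ^ 2 / 6 * Real.log (1 - x) + (1 / 2) * (Real.log x * Real.log (1 - x) ^ 2)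
      = polylog 3 1 := by
  refine eq_of_hasDerivAt_zero_of_tendsto (a := 0) (b := 1 / 2)
    (f := fun x => polylog 3 (1 - x) + polylog 3 x + polylog 3 (x / (x - 1))
      - (1 / 6) * Real.log (1 - x) ^ 3 - Real.pi ^ 2 / 6 * Real.log (1 - x)
      + (1 / 2) * (Real.log x * Real.log (1 - x) ^ 2)) ?_ ?_ hx
  · intro x hx
    have hx1 : x < 1 := by linarith [hx.2]
    have h0' : x ≠ 0 := hx.1.ne'
    have h1' : 1 - x ≠ 0 := by linarith
    have h1'' : x - 1 ≠ 0 := by linarith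
    have hm := landen_arg_mem hx
    have d0 := (hasDerivAt_trilog (x := 1 - x) ⟨by linarith, by linarith [hx.1]⟩ h1').comp x
      ((hasDerivAt_id x).const_sub 1)
    have d1 := hasDerivAt_trilog (x := x) ⟨by linarith [hx.1], hx1⟩ h0'
    have d2 := (hasDerivAt_trilog ⟨hm.1, by linarith [hm.2]⟩ hm.2.ne).comp x
      (hasDerivAt_landen_arg hx1)
    have hl := hasDerivAt_log_one_sub hx1
    have d3 := (hl.pow 3).const_mul (1 / 6 : ℝ)
    have d4 := hl.const_mul (Real.pi ^ 2 / 6)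
    have d5 := ((Real.hasDerivAt_log h0').mul (hl.pow 2)).const_mul (1 / 2 : ℝ)
    refine (((((d0.add d1).add d2).sub d3).sub d4).add d5).congr_deriv ?_
    -- The dilogarithm identities leave only `Li₂(x)`, with coefficient `1/(1-x) + 1/x - 1/(x(1-x))
    -- = 0`.
    have e1 : polylog 2 (x / (x - 1)) = -(1 / 2) * Real.log (1 - x) ^ 2 - polylog 2 x := by
      linarith [dilog_landen hx]
    have e2 : polylog 2 (1 - x) = Real.pi ^ 2 / 6 - Real.log x * Real.log (1 - x) - polylog 2 x := by
      linarith [dilog_add_dilog_one_sub (x := x) ⟨hx.1, hx1⟩]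
    rw [e1, e2]
    have e : x - 1 = -(1 - x) := by ring
    rw [e]
    simp only [Pi.pow_apply]
    field_simp
    push_cast
    ring
  · have hw : 𝓝[Ioo (0 : ℝ) (1 / 2)] 0 ≤ 𝓝 0 := nhdsWithin_le_nhds
    have hm : ∀ᶠ x in 𝓝[Ioo (0 : ℝ) (1 / 2)] 0, x ∈ Ioo (0 : ℝ) (1 / 2) := self_mem_nhdsWithin
    have t0 := tendsto_polylog (s := 3) (by norm_num) (l := 𝓝[Ioo (0 : ℝ) (1 / 2)] 0)
      (g := fun x => 1 - x) (y := 1) (by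
        have : Tendsto (fun x : ℝ => 1 - x) (𝓝 0) (𝓝 (1 - 0)) := by
          exact (continuous_const.sub continuous_id).tendsto 0
        simpa using this.mono_left hw) (by norm_num)
      (hm.mono fun x h => ⟨by linarith [h.2], by linarith [h.1]⟩)
    have t1 := tendsto_polylog (s := 3) (by norm_num) (g := fun x => x) (y := 0) (tendsto_id.mono_left hw) (by norm_num)
      (hm.mono fun x h => ⟨by linarith [h.1], by linarith [h.2]⟩)
    have t2 := tendsto_polylog (s := 3) (by norm_num) (tendsto_landen_arg.mono_left hw)
      (by norm_num)
      (hm.mono fun x h => ⟨(landen_arg_mem h).1.le, by linarith [(landen_arg_mem h).2]⟩)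
    have tl := (hasDerivAt_log_one_sub one_pos).continuousAt.tendsto.mono_left hw
    have t3 := (tl.pow 3).const_mul (1 / 6 : ℝ)
    have t4 := tl.const_mul (Real.pi ^ 2 / 6)
    have t5 := ((tendsto_log_mul_zero hasDerivAt_log_one_sub_sq_zero (by simp)).mono_left
      hw).const_mul (1 / 2 : ℝ)
    simpa [polylog_zero_right] using ((((t0.add t1).add t2).sub t3).sub t4).add t5

lemma dilog_half : polylog 2 (1 / 2) = Real.pi ^ 2 / 12 - (1 / 2) * Real.log 2 ^ 2 := by
  have h := dilog_add_dilog_one_sub (x := 1 / 2) (by norm_num)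
  rw [show (1 : ℝ) - 1 / 2 = 1 / 2 by norm_num, one_div, Real.log_inv] at h
  rw [one_div]
  linarith

lemma trilog_half : polylog 3 (1 / 2)
    = 7 / 8 * polylog 3 1 - Real.pi ^ 2 / 12 * Real.log 2 + (1 / 6) * Real.log 2 ^ 3 := by
  -- At `x = 1/2` the argument `x/(x-1)` reaches `-1`, outside the open range of `trilog_landen`, so
  -- the identity is extended by continuity.
  have hcont : ContinuousOn (fun x => polylog 3 (1 - x) + polylog 3 x + polylog 3 (x / (x - 1))
      - (1 / 6) * Real.log (1 - x) ^ 3 - Real.pi ^ 2 / 6 * Real.log (1 - x)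
      + (1 / 2) * (Real.log x * Real.log (1 - x) ^ 2)) (Ioc 0 (1 / 2)) := by
    have hp := continuousOn_polylog (s := 3) (by norm_num)
    have hl : ContinuousOn (fun x : ℝ => Real.log (1 - x)) (Ioc 0 (1 / 2)) :=
      ContinuousOn.log (by fun_prop) fun x hx => by linarith [hx.2]
    have hl0 : ContinuousOn (fun x : ℝ => Real.log x) (Ioc 0 (1 / 2)) :=
      ContinuousOn.log (by fun_prop) fun x hx => hx.1.ne'
    have h0 : ContinuousOn (fun x : ℝ => polylog 3 (1 - x)) (Ioc 0 (1 / 2)) :=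
      hp.comp (by fun_prop) fun x hx => ⟨by linarith [hx.2], by linarith [hx.1]⟩
    have h1 : ContinuousOn (fun x : ℝ => polylog 3 x) (Ioc 0 (1 / 2)) :=
      hp.mono fun x hx => ⟨by linarith [hx.1], by linarith [hx.2]⟩
    have h2 : ContinuousOn (fun x : ℝ => polylog 3 (x / (x - 1))) (Ioc 0 (1 / 2)) := by
      refine hp.comp (ContinuousOn.div (by fun_prop) (by fun_prop)
        fun x hx => by linarith [hx.2]) fun x hx => ?_
      have h : x - 1 < 0 := by linarith [hx.2]
      exact ⟨by rw [le_div_iff_of_neg h]; linarith [hx.2],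
        (div_nonpos_of_nonneg_of_nonpos hx.1.le h.le).trans zero_le_one⟩
    fun_prop
  have hlim := ((hcont (1 / 2) (by norm_num)).mono (Ioo_subset_Ioc_self)).tendsto
  have : (𝓝[Ioo (0 : ℝ) (1 / 2)] (1 / 2)).NeBot := right_nhdsWithin_Ioo_neBot (by norm_num)
  have h := tendsto_nhds_unique hlim (tendsto_const_nhds.congr' (by
    filter_upwards [self_mem_nhdsWithin] with x hx using (trilog_landen hx).symm))
  norm_num [trilog_neg_one] at h
  rw [one_div, Real.log_inv] at h
  rw [one_div]
  linarith

/-! ### Antiderivatives of the logarithmic integrands. -/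

/-- An antiderivative of `log (1 - u) ^ 2 / u`. -/
noncomputable def primLogOneSubSq (u : ℝ) : ℝ :=
  Real.log u * Real.log (1 - u) ^ 2 + 2 * (Real.log (1 - u) * polylog 2 (1 - u))
    - 2 * polylog 3 (1 - u)

/-- An antiderivative of `log (1 + u) ^ 2 / u`. -/
noncomputable def primLogOneAddSq (u : ℝ) : ℝ :=
  Real.log u * Real.log (1 + u) ^ 2 - 2 / 3 * Real.log (1 + u) ^ 3
    - 2 * (Real.log (1 + u) * polylog 2 (1 / (1 + u))) - 2 * polylog 3 (1 / (1 + u))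

/-- An antiderivative of `(log (1 - u) - log (1 + u)) ^ 2 / u`. -/
noncomputable def primLogSubSq (u : ℝ) : ℝ :=
  Real.log u * (Real.log (1 - u) - Real.log (1 + u)) ^ 2
    + 2 * ((Real.log (1 - u) - Real.log (1 + u))
      * (polylog 2 ((1 - u) / (1 + u)) - polylog 2 (-((1 - u) / (1 + u)))))
    - 2 * (polylog 3 ((1 - u) / (1 + u)) - polylog 3 (-((1 - u) / (1 + u))))

/-- An antiderivative of `log u * log (1 + u) / u`. -/
noncomputable def primLogMulLog (u : ℝ) : ℝ :=
  polylog 3 (-u) - Real.log u * polylog 2 (-u)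

/-- An antiderivative of `(log (1 - u) - log u) * log (1 + u) / u`. -/
noncomputable def primMain (u : ℝ) : ℝ :=
  (1 / 6) * (primLogOneSubSq (u ^ 2) - primLogOneSubSq u - primLogOneAddSq u - primLogSubSq u)
    - primLogMulLog u

lemma hasDerivAt_primLogOneSubSq {u : ℝ} (hu : u ∈ Ioo (0 : ℝ) 1) :
    HasDerivAt primLogOneSubSq (Real.log (1 - u) ^ 2 / u) u := by
  obtain ⟨h0, h1⟩ := hu
  have h0' : u ≠ 0 := h0.ne'
  have h1' : 1 - u ≠ 0 := by linarith
  have hs : HasDerivAt (fun u : ℝ => 1 - u) (-1) u := (hasDerivAt_id u).const_sub 1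
  have hl := hasDerivAt_log_one_sub h1
  have hm : 1 - u ∈ Ioo (-1 : ℝ) 1 := ⟨by linarith, by linarith⟩
  have d2 := (hasDerivAt_dilog hm h1').comp u hs
  have d3 := (hasDerivAt_trilog hm h1').comp u hs
  refine ((((Real.hasDerivAt_log h0').mul (hl.pow 2)).add ((hl.mul d2).const_mul 2)).sub
    (d3.const_mul 2)).congr_deriv ?_
  rw [sub_sub_cancel]
  simp only [Pi.pow_apply, Function.comp_apply]
  field_simp
  push_cast
  ring

lemma hasDerivAt_log_one_add {u : ℝ} (hu : 0 < 1 + u) :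
    HasDerivAt (fun u : ℝ => Real.log (1 + u)) (1 / (1 + u)) u :=
  ((hasDerivAt_id u).const_add 1).log hu.ne'

lemma hasDerivAt_primLogOneAddSq {u : ℝ} (hu : 0 < u) :
    HasDerivAt primLogOneAddSq (Real.log (1 + u) ^ 2 / u) u := by
  have h0' : u ≠ 0 := hu.ne'
  have h1 : 0 < 1 + u := by linarith
  have h1' : 1 + u ≠ 0 := h1.ne'
  have hs : HasDerivAt (fun u : ℝ => 1 / (1 + u)) (-1 / (1 + u) ^ 2) u := by
    simpa using ((hasDerivAt_id u).const_add 1).fun_inv h1'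
  have hl := hasDerivAt_log_one_add h1
  have hp : 0 < 1 / (1 + u) := by positivity
  have hm : 1 / (1 + u) ∈ Ioo (-1 : ℝ) 1 := ⟨by linarith, by rw [div_lt_one h1]; linarith⟩
  have d2 := (hasDerivAt_dilog hm hp.ne').comp u hs
  have d3 := (hasDerivAt_trilog hm hp.ne').comp u hs
  refine (((((Real.hasDerivAt_log h0').mul (hl.pow 2)).sub ((hl.pow 3).const_mul (2 / 3))).sub
    ((hl.mul d2).const_mul 2)).sub (d3.const_mul 2)).congr_deriv ?_
  -- The extra `log(1+u)` here is what the cubic term of `primLogOneAddSq` compensates.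
  have e : Real.log (1 - 1 / (1 + u)) = Real.log u - Real.log (1 + u) := by
    rw [← Real.log_div h0' h1']
    congr 1
    field_simp
    ring
  rw [e]
  simp only [Pi.pow_apply, Function.comp_apply]
  field_simp
  push_cast
  ring

lemma cayley_mem {u : ℝ} (hu : u ∈ Ioo (0 : ℝ) 1) : (1 - u) / (1 + u) ∈ Ioo (0 : ℝ) 1 := by
  have h1 : 0 < 1 + u := by linarith [hu.1]
  exact ⟨div_pos (by linarith [hu.2]) h1, by rw [div_lt_one h1]; linarith [hu.1]⟩

lemma hasDerivAt_primLogSubSq {u : ℝ} (hu : u ∈ Ioo (0 : ℝ) 1) :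
    HasDerivAt primLogSubSq ((Real.log (1 - u) - Real.log (1 + u)) ^ 2 / u) u := by
  obtain ⟨hv0, hv1⟩ := cayley_mem hu
  obtain ⟨h0, h1⟩ := hu
  have h0' : u ≠ 0 := h0.ne'
  have ha : 0 < 1 + u := by linarith
  have ha' : 1 + u ≠ 0 := ha.ne'
  have hb' : 1 - u ≠ 0 := by linarith
  have hs : HasDerivAt (fun u : ℝ => (1 - u) / (1 + u)) (-2 / (1 + u) ^ 2) u := by
    refine (((hasDerivAt_id u).const_sub 1).div ((hasDerivAt_id u).const_add 1) ha').congr_deriv ?_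
    simp only [id]
    ring
  have hl := (hasDerivAt_log_one_sub h1).sub (hasDerivAt_log_one_add ha)
  have hm : (1 - u) / (1 + u) ∈ Ioo (-1 : ℝ) 1 := ⟨by linarith, hv1⟩
  have hm' : -((1 - u) / (1 + u)) ∈ Ioo (-1 : ℝ) 1 := ⟨by linarith, by linarith⟩
  have hn : -((1 - u) / (1 + u)) ≠ 0 := by linarith
  have d2 := (hasDerivAt_dilog hm hv0.ne').comp u hs
  have d3 := (hasDerivAt_trilog hm hv0.ne').comp u hs
  have d2' := (hasDerivAt_dilog hm' hn).comp u hs.neg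
  have d3' := (hasDerivAt_trilog hm' hn).comp u hs.neg
  refine ((((Real.hasDerivAt_log h0').mul (hl.pow 2)).add
    ((hl.mul (d2.sub d2')).const_mul 2)).sub ((d3.sub d3').const_mul 2)).congr_deriv ?_
  -- With `v = (1-u)/(1+u)`, `log(1-v) - log(1+v) = log u`: the `log 2` terms cancel, which is why
  -- `Li(v) - Li(-v)` appears.
  have e1 : Real.log (1 - (1 - u) / (1 + u)) = Real.log 2 + Real.log u - Real.log (1 + u) := by
    rw [← Real.log_mul two_ne_zero h0', ← Real.log_div (by positivity) ha']
    congr 1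
    field_simp
    ring
  have e2 : Real.log (1 - -((1 - u) / (1 + u))) = Real.log 2 - Real.log (1 + u) := by
    rw [← Real.log_div two_ne_zero ha']
    congr 1
    field_simp
    ring
  rw [e1, e2]
  simp only [Pi.pow_apply, Pi.sub_apply, Pi.neg_apply, Function.comp_apply]
  field_simp
  push_cast
  ring

lemma hasDerivAt_primLogMulLog {u : ℝ} (hu : u ∈ Ioo (0 : ℝ) 1) :
    HasDerivAt primLogMulLog (Real.log u * Real.log (1 + u) / u) u := by
  obtain ⟨h0, h1⟩ := hu
  have h0' : u ≠ 0 := h0.ne'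
  have hm : -u ∈ Ioo (-1 : ℝ) 1 := ⟨by linarith, by linarith⟩
  have hn : -u ≠ 0 := neg_ne_zero.2 h0'
  have d2 := (hasDerivAt_dilog hm hn).comp u (hasDerivAt_neg u)
  have d3 := (hasDerivAt_trilog hm hn).comp u (hasDerivAt_neg u)
  refine (d3.sub ((Real.hasDerivAt_log h0').mul d2)).congr_deriv ?_
  rw [sub_neg_eq_add]
  simp only [Function.comp_apply]
  field_simp
  ring

/-- With `a = log(1-u)` and `b = log(1+u)`, `2(a+b)² - a² - b² - (a-b)² = 6ab`. The factor `2`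
arises from the chain rule at `u²`. -/
lemma hasDerivAt_primMain {u : ℝ} (hu : u ∈ Ioo (0 : ℝ) 1) :
    HasDerivAt primMain ((Real.log (1 - u) - Real.log u) * Real.log (1 + u) / u) u := by
  have h0' : u ≠ 0 := hu.1.ne'
  have hsq : u ^ 2 ∈ Ioo (0 : ℝ) 1 := ⟨pow_pos hu.1 2, pow_lt_one₀ hu.1.le hu.2 two_ne_zero⟩
  have dq := HasDerivAt.comp (h := fun x : ℝ => x ^ 2) u (hasDerivAt_primLogOneSubSq hsq)
    (hasDerivAt_pow 2 u)
  refine (((((dq.sub (hasDerivAt_primLogOneSubSq hu)).sub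
    (hasDerivAt_primLogOneAddSq hu.1)).sub (hasDerivAt_primLogSubSq hu)).const_mul (1 / 6)).sub
    (hasDerivAt_primLogMulLog hu)).congr_deriv ?_
  have e : Real.log (1 - u ^ 2) = Real.log (1 - u) + Real.log (1 + u) := by
    rw [← Real.log_mul (by linarith [hu.2]) (by linarith [hu.1])]
    congr 1
    ring
  rw [e]
  field_simp
  push_cast
  ring

/-! ### Values of the antiderivative at the endpoints and its limit at 0. -/

lemma primMain_zero : primMain 0 = 11 / 12 * polylog 3 1 := by
  -- The convention `Real.log 0 = 0` agrees with the limits, as every `log u` is multiplied by a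
  -- function vanishing at `0`.
  simp [primMain, primLogOneSubSq, primLogOneAddSq, primLogSubSq, primLogMulLog,
    polylog_zero_right, trilog_neg_one]
  ring

lemma primMain_half : primMain (1 / 2) = 35 / 24 * polylog 3 1 := by
  have hl4 : Real.log 4 = 2 * Real.log 2 := by
    rw [show (4 : ℝ) = 2 ^ 2 by norm_num, Real.log_pow]
    norm_num
  have l2 : Real.log (1 / 2) = -Real.log 2 := by rw [one_div, Real.log_inv]
  have l14 : Real.log (1 / 4) = -(2 * Real.log 2) := by rw [one_div, Real.log_inv, hl4]
  have l13 : Real.log (1 / 3) = -Real.log 3 := by rw [one_div, Real.log_inv]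
  have l34 : Real.log (3 / 4) = Real.log 3 - 2 * Real.log 2 := by
    rw [Real.log_div (by norm_num) (by norm_num), hl4]
  have l32 : Real.log (3 / 2) = Real.log 3 - Real.log 2 := by
    rw [Real.log_div (by norm_num) (by norm_num)]
  have l23 : Real.log (2 / 3) = Real.log 2 - Real.log 3 := by
    rw [Real.log_div (by norm_num) (by norm_num)]
  have q14 := polylog_sq (s := 1) le_rfl (x := 1 / 2) (by norm_num)
  have q34 := dilog_add_dilog_one_sub (x := 1 / 4) (by norm_num)
  have q23 := dilog_add_dilog_one_sub (x := 1 / 3) (by norm_num)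
  have m13 := dilog_landen (x := 1 / 4) (by norm_num)
  have m12 := dilog_landen (x := 1 / 3) (by norm_num)
  have t14 := polylog_sq (s := 2) (by norm_num) (x := 1 / 2) (by norm_num)
  have t34 := trilog_landen (x := 1 / 4) (by norm_num)
  have t23 := trilog_landen (x := 1 / 3) (by norm_num)
  have q12 := dilog_half
  have t12 := trilog_half
  norm_num only at q14 q34 q23 m13 m12 t14 t34 t23 q12 t12
  simp only [l14, l13, l34, l23] at q34 q23 m13 m12 t34 t23
  unfold primMain primLogOneSubSq primLogOneAddSq primLogSubSq primLogMulLog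
  norm_num only
  simp only [l2, l14, l34, l32]
  have p34 := eq_sub_of_add_eq' q34
  have p23 := eq_sub_of_add_eq' q23
  have p13' := eq_sub_of_add_eq' m13
  have p13 := eq_sub_of_add_eq m12
  -- Every dilogarithm is now expressed through `Li₂(-1/2)`, whose total coefficient vanishes.
  rw [p34, p23, p13', p13, q14, q12]
  -- `Li₃(3/4)` and `Li₃(2/3)` force the coefficients `∓1/3`; `Li₃(1/4)` then forces `1/3`, leaving
  -- `5/3 * Li₃(1/2)`, hence `5/3 * 7/8 = 35/24`.
  linear_combination (-1 / 3) * t34 + (1 / 3) * t23 + (1 / 3) * t14 + (5 / 3) * t12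

lemma tendsto_primLogOneSubSq_zero :
    Tendsto primLogOneSubSq (𝓝[>] 0) (𝓝 (primLogOneSubSq 0)) := by
  have hw : 𝓝[>] (0 : ℝ) ≤ 𝓝 0 := nhdsWithin_le_nhds
  have hm : ∀ᶠ x in 𝓝[>] (0 : ℝ), x ∈ Ioo (0 : ℝ) 1 := Ioo_mem_nhdsGT one_pos
  have ts : Tendsto (fun x : ℝ => 1 - x) (𝓝[>] 0) (𝓝 (1 - 0)) :=
    ((continuous_const.sub continuous_id).tendsto 0).mono_left hw
  have hs : ∀ᶠ x in 𝓝[>] (0 : ℝ), 1 - x ∈ Icc (-1 : ℝ) 1 :=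
    hm.mono fun x h => ⟨by linarith [h.2], by linarith [h.1]⟩
  have t2 := tendsto_polylog (s := 2) le_rfl ts (by norm_num) hs
  have t3 := tendsto_polylog (s := 3) (by norm_num) ts (by norm_num) hs
  have tl := (hasDerivAt_log_one_sub one_pos).continuousAt.tendsto.mono_left hw
  have tm := (tendsto_log_mul_zero hasDerivAt_log_one_sub_sq_zero (by simp)).mono_left hw
  have h := (tm.add ((tl.mul t2).const_mul 2)).sub (t3.const_mul 2)
  convert h using 2 <;> simp [primLogOneSubSq]

lemma tendsto_primLogOneAddSq_zero :
    Tendsto primLogOneAddSq (𝓝[>] 0) (𝓝 (primLogOneAddSq 0)) := by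
  have hw : 𝓝[>] (0 : ℝ) ≤ 𝓝 0 := nhdsWithin_le_nhds
  have ts : Tendsto (fun x : ℝ => 1 / (1 + x)) (𝓝[>] 0) (𝓝 (1 / (1 + 0))) := by
    have : ContinuousAt (fun x : ℝ => 1 / (1 + x)) 0 :=
      continuousAt_const.div (by fun_prop) (by norm_num)
    exact this.tendsto.mono_left hw
  have hs : ∀ᶠ x in 𝓝[>] (0 : ℝ), 1 / (1 + x) ∈ Icc (-1 : ℝ) 1 := by
    filter_upwards [self_mem_nhdsWithin] with x (hx : 0 < x)
    have h1 : 0 < 1 + x := by linarith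
    have h2 : 0 < 1 / (1 + x) := by positivity
    exact ⟨by linarith, by rw [div_le_one h1]; linarith⟩
  have t2 := tendsto_polylog (s := 2) le_rfl ts (by norm_num) hs
  have t3 := tendsto_polylog (s := 3) (by norm_num) ts (by norm_num) hs
  have hl := hasDerivAt_log_one_add (u := 0) (by norm_num)
  have tl := hl.continuousAt.tendsto.mono_left hw
  have tm := (tendsto_log_mul_zero (hl.pow 2) (by simp)).mono_left hw
  have h := ((tm.sub ((tl.pow 3).const_mul (2 / 3))).sub ((tl.mul t2).const_mul 2)).sub
    (t3.const_mul 2)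
  convert h using 2 <;> simp [primLogOneAddSq]

lemma tendsto_primLogSubSq_zero :
    Tendsto primLogSubSq (𝓝[>] 0) (𝓝 (primLogSubSq 0)) := by
  have hw : 𝓝[>] (0 : ℝ) ≤ 𝓝 0 := nhdsWithin_le_nhds
  have hm : ∀ᶠ x in 𝓝[>] (0 : ℝ), x ∈ Ioo (0 : ℝ) 1 := Ioo_mem_nhdsGT one_pos
  have ts : Tendsto (fun x : ℝ => (1 - x) / (1 + x)) (𝓝[>] 0) (𝓝 ((1 - 0) / (1 + 0))) := by
    have : ContinuousAt (fun x : ℝ => (1 - x) / (1 + x)) 0 :=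
      ContinuousAt.div (by fun_prop) (by fun_prop) (by norm_num)
    exact this.tendsto.mono_left hw
  have hs : ∀ᶠ x in 𝓝[>] (0 : ℝ), (1 - x) / (1 + x) ∈ Icc (-1 : ℝ) 1 :=
    hm.mono fun x h => ⟨by linarith [(cayley_mem h).1], (cayley_mem h).2.le⟩
  have hs' : ∀ᶠ x in 𝓝[>] (0 : ℝ), -((1 - x) / (1 + x)) ∈ Icc (-1 : ℝ) 1 :=
    hs.mono fun x h => ⟨by linarith [h.2], by linarith [h.1]⟩
  have t2 := tendsto_polylog (s := 2) le_rfl ts (by norm_num) hs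
  have t3 := tendsto_polylog (s := 3) (by norm_num) ts (by norm_num) hs
  have t2' := tendsto_polylog (s := 2) le_rfl ts.neg (by norm_num) hs'
  have t3' := tendsto_polylog (s := 3) (by norm_num) ts.neg (by norm_num) hs'
  have hl := (hasDerivAt_log_one_sub (x := 0) one_pos).sub
    (hasDerivAt_log_one_add (u := 0) (by norm_num))
  have tl := hl.continuousAt.tendsto.mono_left hw
  have tm := (tendsto_log_mul_zero (hl.pow 2) (by simp)).mono_left hw
  have h := (tm.add ((tl.mul (t2.sub t2')).const_mul 2)).sub ((t3.sub t3').const_mul 2)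
  convert h using 2 <;> simp [primLogSubSq]

lemma tendsto_primLogMulLog_zero :
    Tendsto primLogMulLog (𝓝[>] 0) (𝓝 (primLogMulLog 0)) := by
  have hw : 𝓝[>] (0 : ℝ) ≤ 𝓝 0 := nhdsWithin_le_nhds
  have hn : HasDerivAt (fun x : ℝ => -x) (-1) 0 := hasDerivAt_neg 0
  have h2 := (hasDerivAt_polylog_series 1 (x := -0) (by norm_num)).comp 0 hn
  have h3 := (hasDerivAt_polylog_series 2 (x := -0) (by norm_num)).comp 0 hn
  have tm := (tendsto_log_mul_zero h2 (by simp [polylog_zero_right])).mono_left hw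
  have h := (h3.continuousAt.tendsto.mono_left hw).sub tm
  convert h using 2 <;> simp [primLogMulLog]

lemma tendsto_primMain_zero : Tendsto primMain (𝓝[>] 0) (𝓝 (primMain 0)) := by
  have hsq : Tendsto (fun x : ℝ => x ^ 2) (𝓝[>] 0) (𝓝[>] 0) := by
    refine tendsto_nhdsWithin_iff.2 ⟨?_, ?_⟩
    · have : Tendsto (fun x : ℝ => x ^ 2) (𝓝 0) (𝓝 (0 ^ 2)) := (continuous_pow 2).tendsto 0
      rw [zero_pow two_ne_zero] at this
      exact this.mono_left nhdsWithin_le_nhds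
    · filter_upwards [self_mem_nhdsWithin] with x hx using pow_pos (mem_Ioi.1 hx) 2
  have h := ((((tendsto_primLogOneSubSq_zero.comp hsq).sub tendsto_primLogOneSubSq_zero).sub
    tendsto_primLogOneAddSq_zero).sub tendsto_primLogSubSq_zero).const_mul (1 / 6) |>.sub
    tendsto_primLogMulLog_zero
  convert h using 2 <;> simp [primMain]

/-! ### The kernel and its integral. -/

/-- The function whose power series expansion integrates to the triple sum. -/
noncomputable def sumKernel (t : ℝ) : ℝ :=
  1 / 2 * (Real.log (1 + t) - Real.log (1 - t)) * (1 - t)⁻¹ * (Real.log (3 - t) - Real.log 2)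

lemma sumKernel_nonneg {t : ℝ} (ht : t ∈ Ioo (0 : ℝ) 1) : 0 ≤ sumKernel t := by
  have h1 : 0 ≤ Real.log (1 + t) - Real.log (1 - t) :=
    sub_nonneg.2 (Real.log_le_log (by linarith [ht.2]) (by linarith [ht.1]))
  have h2 : 0 ≤ Real.log (3 - t) - Real.log 2 :=
    sub_nonneg.2 (Real.log_le_log (by norm_num) (by linarith [ht.2]))
  have h3 : 0 ≤ (1 - t)⁻¹ := inv_nonneg.2 (by linarith [ht.2])
  unfold sumKernel
  positivity

lemma half_one_sub_mem {t : ℝ} (ht : t ∈ Ico (0 : ℝ) 1) : (1 - t) / 2 ∈ Ioo (0 : ℝ) 1 :=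
  ⟨by linarith [ht.2], by linarith [ht.1]⟩

lemma hasDerivAt_half_one_sub (t : ℝ) : HasDerivAt (fun t : ℝ => (1 - t) / 2) (-1 / 2) t :=
  ((hasDerivAt_id t).const_sub 1).div_const 2

lemma hasDerivAt_prim_sumKernel {t : ℝ} (ht : t ∈ Ioo (0 : ℝ) 1) :
    HasDerivAt (fun t => -(1 / 2) * primMain ((1 - t) / 2)) (sumKernel t) t := by
  have h := ((hasDerivAt_primMain (half_one_sub_mem ⟨ht.1.le, ht.2⟩)).comp t
    (hasDerivAt_half_one_sub t)).const_mul (-(1 / 2))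
  refine h.congr_deriv ?_
  have p1 : 1 - t ≠ 0 := by linarith [ht.2]
  have p2 : 1 + t ≠ 0 := by linarith [ht.1]
  have p3 : 3 - t ≠ 0 := by linarith [ht.2]
  rw [show 1 - (1 - t) / 2 = (1 + t) / 2 by ring, show 1 + (1 - t) / 2 = (3 - t) / 2 by ring,
    Real.log_div p1 two_ne_zero, Real.log_div p2 two_ne_zero, Real.log_div p3 two_ne_zero, sumKernel]
  field_simp
  ring

lemma continuousOn_prim_sumKernel :
    ContinuousOn (fun t => -(1 / 2) * primMain ((1 - t) / 2)) (Icc 0 1) := by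
  refine continuousOn_const.mul fun t ht => ?_
  rcases eq_or_lt_of_le ht.2 with rfl | h1
  -- At `t = 1`, i.e. `u = 0`, only the one-sided limit of `primMain` is available.
  · rw [← continuousWithinAt_sdiff_self]
    unfold ContinuousWithinAt
    beta_reduce
    rw [sub_self, zero_div]
    refine tendsto_primMain_zero.comp (tendsto_nhdsWithin_iff.2 ⟨?_, ?_⟩)
    · have := (hasDerivAt_half_one_sub 1).continuousAt.tendsto
      rw [sub_self, zero_div] at this
      exact this.mono_left nhdsWithin_le_nhds
    · filter_upwards [self_mem_nhdsWithin] with x hx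
      have : x < 1 := lt_of_le_of_ne hx.1.2 hx.2
      exact mem_Ioi.2 (by linarith)
  · exact ((hasDerivAt_primMain (half_one_sub_mem ⟨ht.1, h1⟩)).comp t
      (hasDerivAt_half_one_sub t)).continuousAt.continuousWithinAt

/-- A nonnegative derivative of a function continuous on the closed interval is integrable, so no
estimate at `t = 1` is needed. -/
lemma integrableOn_sumKernel : IntegrableOn sumKernel (Ioc 0 1) :=
  intervalIntegral.integrableOn_deriv_of_nonneg continuousOn_prim_sumKernel
    (fun _ => hasDerivAt_prim_sumKernel) (fun _ => sumKernel_nonneg)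

lemma integral_sumKernel : ∫ t in Ioo (0 : ℝ) 1, sumKernel t = 13 / 48 * polylog 3 1 := by
  rw [← integral_Ioc_eq_integral_Ioo, ← intervalIntegral.integral_of_le zero_le_one,
    intervalIntegral.integral_eq_sub_of_hasDerivAt_of_le zero_le_one continuousOn_prim_sumKernel
      (fun _ => hasDerivAt_prim_sumKernel)
      ((intervalIntegrable_iff_integrableOn_Ioc_of_le zero_le_one).2 integrableOn_sumKernel)]
  rw [sub_self, zero_div, sub_zero, primMain_zero, primMain_half]
  ring

/-! ### Series expansion and termwise integration. -/

/-- The summand of the power series of `sumKernel`, with `k = 2 i + 1`, `m = j + 1`, `n = l + 1`. -/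
noncomputable def kernelTerm (p : ℕ × ℕ × ℕ) (t : ℝ) : ℝ :=
  t ^ (2 * p.1 + 1) / (2 * p.1 + 1) *
    (t ^ p.2.1 * ((1 / 3) ^ (p.2.2 + 1) / (p.2.2 + 1) - (t / 3) ^ (p.2.2 + 1) / (p.2.2 + 1)))

lemma kernelTerm_nonneg (p : ℕ × ℕ × ℕ) {t : ℝ} (ht : t ∈ Ioo (0 : ℝ) 1) :
    0 ≤ kernelTerm p t := by
  have h0 := ht.1
  have h : 0 ≤ (1 / 3 : ℝ) ^ (p.2.2 + 1) / (p.2.2 + 1) - (t / 3) ^ (p.2.2 + 1) / (p.2.2 + 1) := by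
    rw [sub_nonneg]
    have := ht.2.le
    gcongr
  unfold kernelTerm
  positivity

lemma hasSum_kernelTerm {t : ℝ} (ht : t ∈ Ioo (0 : ℝ) 1) :
    HasSum (fun p => kernelTerm p t) (sumKernel t) := by
  obtain ⟨h0, h1⟩ := ht
  have ha : HasSum (fun i : ℕ => t ^ (2 * i + 1) / (2 * i + 1 : ℝ))
      (1 / 2 * (Real.log (1 + t) - Real.log (1 - t))) := by
    have := (Real.hasSum_log_sub_log_of_abs_lt_one (abs_lt.2 ⟨by linarith, h1⟩)).mul_left (1 / 2)
    refine this.congr_fun ?_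
    intro i
    ring
  have hb : HasSum (fun j : ℕ => t ^ j) (1 - t)⁻¹ := hasSum_geometric_of_lt_one h0.le h1
  have hc : HasSum (fun l : ℕ =>
      ((1 / 3 : ℝ) ^ (l + 1) / (l + 1) - (t / 3) ^ (l + 1) / (l + 1)))
      (Real.log (3 - t) - Real.log 2) := by
    have e1 := Real.hasSum_pow_div_log_of_abs_lt_one (x := 1 / 3) (by norm_num [abs_lt])
    have e2 := Real.hasSum_pow_div_log_of_abs_lt_one (x := t / 3)
      (abs_lt.2 ⟨by linarith, by linarith⟩)
    suffices e : Real.log (3 - t) - Real.log 2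
        = -Real.log (1 - 1 / 3) - -Real.log (1 - t / 3) by
      rw [e]
      exact e1.sub e2
    rw [show (1 : ℝ) - 1 / 3 = 2 / 3 by norm_num, show 1 - t / 3 = (3 - t) / 3 by ring,
      Real.log_div (by norm_num) (by norm_num), Real.log_div (by linarith) (by norm_num)]
    ring
  have na : ∀ i : ℕ, 0 ≤ t ^ (2 * i + 1) / (2 * i + 1 : ℝ) := fun i => by positivity
  have nb : ∀ j : ℕ, 0 ≤ t ^ j := fun j => by positivity
  have nc : ∀ l : ℕ, 0 ≤ (1 / 3 : ℝ) ^ (l + 1) / (l + 1) - (t / 3) ^ (l + 1) / (l + 1) := by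
    intro l
    rw [sub_nonneg]
    gcongr
  have hbc := hb.mul hc (hb.summable.mul_of_nonneg hc.summable nb nc)
  have h := ha.mul hbc (ha.summable.mul_of_nonneg hbc.summable na
    fun q => mul_nonneg (nb q.1) (nc q.2))
  rw [sumKernel, mul_assoc]
  exact h

lemma continuous_kernelTerm (p : ℕ × ℕ × ℕ) : Continuous (kernelTerm p) := by
  unfold kernelTerm
  fun_prop

lemma integral_kernelTerm (p : ℕ × ℕ × ℕ) : ∫ t in Ioo (0 : ℝ) 1, kernelTerm p t =
    1 / 3 ^ (p.2.2 + 1) * (1 / ((2 * p.1 + 1) * ((2 * p.1 + 1) + (p.2.1 + 1)) *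
      ((2 * p.1 + 1) + (p.2.1 + 1) + (p.2.2 + 1)))) := by
  obtain ⟨i, j, l⟩ := p
  have e : ∀ t : ℝ, kernelTerm (i, j, l) t = 1 / ((2 * i + 1) * (3 ^ (l + 1) * (l + 1))) *
      (t ^ (2 * i + 1 + j) - t ^ (2 * i + 1 + j + (l + 1))) := by
    intro t
    simp only [kernelTerm, div_pow, one_pow]
    rw [pow_add t (2 * i + 1 + j), pow_add t (2 * i + 1)]
    field_simp
  simp only [e]
  rw [← integral_Ioc_eq_integral_Ioo, ← intervalIntegral.integral_of_le zero_le_one,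
    intervalIntegral.integral_const_mul, intervalIntegral.integral_sub
      (Continuous.intervalIntegrable (by fun_prop) _ _)
      (Continuous.intervalIntegrable (by fun_prop) _ _), integral_pow, integral_pow]
  simp only [one_pow, ne_eq, Nat.add_eq_zero_iff, one_ne_zero, and_false, not_false_eq_true,
    zero_pow, sub_zero]
  push_cast
  have h1 : (2 * i + 1 + j + 1 : ℝ) ≠ 0 := by positivity
  have h2 : (2 * i + 1 + j + (l + 1) + 1 : ℝ) ≠ 0 := by positivity
  have h3 : (2 * i + 1 + (j + 1) : ℝ) ≠ 0 := by positivity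
  have h4 : (2 * i + 1 + (j + 1) + (l + 1) : ℝ) ≠ 0 := by positivity
  have h5 : (l + 1 : ℝ) ≠ 0 := by positivity
  have h6 : (2 * i + 1 : ℝ) ≠ 0 := by positivity
  field_simp
  ring

lemma hasSum_integral_kernelTerm :
    HasSum (fun p => ∫ t in Ioo (0 : ℝ) 1, kernelTerm p t) (13 / 48 * polylog 3 1) := by
  rw [← integral_sumKernel]
  -- By nonnegativity each term is its own bound, and the bounds sum to the integrable kernel.
  refine hasSum_integral_of_dominated_convergence kernelTerm
    (fun p => (continuous_kernelTerm p).aestronglyMeasurable) (fun p => ?_) ?_ ?_ ?_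
  · filter_upwards [ae_restrict_mem measurableSet_Ioo] with t ht
    rw [Real.norm_of_nonneg (kernelTerm_nonneg p ht)]
  · filter_upwards [ae_restrict_mem measurableSet_Ioo] with t ht
      using (hasSum_kernelTerm ht).summable
  · refine (integrableOn_sumKernel.mono_set Ioo_subset_Ioc_self).congr ?_
    filter_upwards [ae_restrict_mem measurableSet_Ioo] with t ht
      using (hasSum_kernelTerm ht).tsum_eq.symm
  · filter_upwards [ae_restrict_mem measurableSet_Ioo] with t ht using hasSum_kernelTerm ht

/-! ### Reindexing and conclusion. -/

/-- Triples of positive integers with odd first entry, parametrized by `ℕ × ℕ × ℕ`. -/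
def oddTripleEquiv :
    ℕ × ℕ × ℕ ≃ {p : ℕ × ℕ × ℕ // (1 ≤ p.1 ∧ 1 ≤ p.2.1 ∧ 1 ≤ p.2.2) ∧ Odd p.1} where
  toFun p := ⟨(2 * p.1 + 1, p.2.1 + 1, p.2.2 + 1), by simp⟩
  invFun p := (p.1.1 / 2, p.1.2.1 - 1, p.1.2.2 - 1)
  left_inv p := by
    ext <;> simp
    omega
  right_inv := by
    rintro ⟨⟨k, m, n⟩, ⟨hk, hm, hn⟩, c, hc⟩
    simp only at hk hm hn hc
    ext <;> simp only <;> omega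

theorem theorem3 :
    HasSum
      (fun p : {p : ℕ × ℕ × ℕ // (1 ≤ p.1 ∧ 1 ≤ p.2.1 ∧ 1 ≤ p.2.2) ∧ Odd p.1} =>
        let k : ℂ := (p.1.1 : ℂ)
        let m : ℂ := (p.1.2.1 : ℂ)
        let n : ℂ := (p.1.2.2 : ℂ)
        (1 / (3 : ℂ) ^ p.1.2.2) * (1 / (k * (k + m) * (k + m + n))))
      (13 / 48 * riemannZeta 3) := by
  rw [← oddTripleEquiv.hasSum_iff, ← ofReal_polylog_three_one]
  have h := Complex.hasSum_ofReal.2 hasSum_integral_kernelTerm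
  simp only [integral_kernelTerm] at h
  push_cast at h
  refine h.congr_fun ?_
  intro p
  simp [oddTripleEquiv]
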